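/- **Setting.** Let $(A,B,C)$, with $A\in\mathbb R^{n\times n}$, $B\in\mathbb R^{n\times m}$, $C\in\mathbb R^{m\times n}$, be a minimal (controllable and observable) and passive linear system, the agent. Let $L\in\mathbb R^{N\times N}$ be the Laplacian of a connected undirected graph on $N$ nodes with nonnegative weights, $F\in\mathbb R^{N\times p}$, $H\in\mathbb R^{q\times N}$, and let $$\Sigma:\quad \dot x=(I_N\otimes A-L\otimes BC)x+(F\otimes B)u,\qquad y=(H\otimes C)x .$$ Write $L=T\,\mathrm{diag}(\bar\Lambda,0)\,T^\top$ with $T=[T_1\ \ \mathbf 1_N/\sqrt N]$ orthogonal and $\bar\Lambda=\mathrm{diag}(\lambda_1,\dots,\lambda_{N-1})$, $\lambda_1\ge\dots\ge\lambda_{N-1}>0$; put $\bar F=T_1^\top F$, $\bar H=HT_1$. The stable part of $\Sigma$ is $$\Sigma_s:\quad \dot z=(I_{N-1}\otimes A-\bar\Lambda\otimes BC)z+(\bar F\otimes B)u,\qquad y_s=(\bar H\otimes C)z .$$ **Gramians and balancing.** Let $X=X^\top>0$ satisfy $-\bar\Lambda X-X\bar\Lambda+\bar F\bar F^\top=0$,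 and let $Y=Y^\top>0$ satisfy $-\bar\Lambda Y-Y\bar\Lambda+\bar H^\top\bar H\le 0$, where $Y$ is block diagonal with respect to the blocks of equal diagonal entries of $\bar\Lambda$. Let $K_m$ and $K_M$ be the minimum and the maximum (in the Loewner order) of the symmetric positive definite solutions $K$ of $A^\top K+KA\le 0$, $C=B^\top K$. Let $T_{\mathcal G},T_{\mathcal D}$ be nonsingular with $$T_{\mathcal G}XT_{\mathcal G}^\top=T_{\mathcal G}^{-\top}YT_{\mathcal G}^{-1}=\mathrm{diag}(\sigma_1,\dots,\sigma_{N-1}),\qquad T_{\mathcal D}K_M^{-1}T_{\mathcal D}^\top=T_{\mathcal D}^{-\top}K_mT_{\mathcal D}^{-1}=\mathrm{diag}(\tau_1,\dots,\tau_n),$$ $\sigma_1\ge\dots\ge\sigma_{N-1}$, $\tau_1\ge\dots\ge\tau_n$. **Reduced model.** Let $1\le k\le N$. Let $\hat\Lambda_1$ be the leading $(k-1)\times(k-1)$ block of $T_{\mathcal G}\bar\Lambda T_{\mathcal G}^{-1}$, $\hat F_1$ the first $k-1$ rows of $T_{\mathcal G}\bar F$ and $\hat H_1$ the first $k-1$ columns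 of $\bar HT_{\mathcal G}^{-1}$. The agent is not reduced: $(\hat A,\hat B,\hat C)=(RAR^{-1},RB,CR^{-1})$ for some nonsingular $R$ (for example $R=I_n$, or $R=T_{\mathcal D}$). Let $$\hat\Sigma_s:\quad \dot{\hat z}=(I_{k-1}\otimes\hat A-\hat\Lambda_1\otimes\hat B\hat C)\hat z+(\hat F_1\otimes\hat B)u,\qquad \hat y_s=(\hat H_1\otimes\hat C)\hat z,$$ $$\mathcal N=\begin{bmatrix}\hat\Lambda_1&0\\0&0\end{bmatrix},\quad \mathcal F=\begin{bmatrix}\hat F_1\\ \tfrac1{\sqrt N}\mathbf 1_N^\top F\end{bmatrix},\quad \mathcal H=\begin{bmatrix}\hat H_1&\tfrac1{\sqrt N}H\mathbf 1_N\end{bmatrix}.$$ Let $\mathcal T_n$ be nonsingular such that $\hat L=\mathcal T_n^{-1}\mathcal N\mathcal T_n$ is the Laplacian of a connected undirected graph on $k$ nodes with nonnegative weights, and let $$\hat\Sigma:\quad \dot{\hat x}=(I_k\otimes\hat A-\hat L\otimes\hat B\hat C)\hat x+(\mathcal T_n^{-1}\mathcal F\otimes\hat B)u,\qquad \hat y=(\mathcal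 H\mathcal T_n\otimes\hat C)\hat x .$$ **Theorem.** The transfer functions of $\Sigma-\hat\Sigma$ and $\Sigma_s-\hat\Sigma_s$ belong to $\mathcal H_\infty$ (holomorphic and bounded on $\operatorname{Re}s>0$), and $$\|\Sigma-\hat\Sigma\|_{\mathcal H_\infty}=\|\Sigma_s-\hat\Sigma_s\|_{\mathcal H_\infty}\le 2\sum_{i=k}^{N-1}\sum_{j=1}^{n}\sigma_i\tau_j ,$$ where $\|G\|_{\mathcal H_\infty}=\sup_{\operatorname{Re}s>0}\|G(s)\|_2$. -/

import Mathlib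

open scoped Matrix Kronecker ENNReal

noncomputable section

namespace NetBT

/-! ### Linear systems, transfer functions and the `H∞`-norm -/

/-- The linear system `ẋ = A x + B u`, `y = C x` with states indexed by `ι`, inputs indexed by
`μ` and outputs indexed by `ο`. -/
structure LinSys (ι μ ο : Type*) where
  A : Matrix ι ι ℝ
  B : Matrix ι μ ℝ
  C : Matrix ο ι ℝ

/-- The transfer function `s ↦ C (s I - A)⁻¹ B`. -/
def LinSys.transfer {ι μ ο : Type*} [Fintype ι] [DecidableEq ι] (S : LinSys ι μ ο) (s : ℂ) :
    Matrix ο μ ℂ :=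
  S.C.map Complex.ofReal *
    (s • (1 : Matrix ι ι ℂ) - S.A.map Complex.ofReal)⁻¹ * S.B.map Complex.ofReal

/-- The difference `S₁ - S₂` of two linear systems with the same inputs and outputs, as the
difference of their transfer functions. -/
def errorTransfer {ι₁ ι₂ μ ο : Type*} [Fintype ι₁] [DecidableEq ι₁] [Fintype ι₂] [DecidableEq ι₂]
    (S₁ : LinSys ι₁ μ ο) (S₂ : LinSys ι₂ μ ο) (s : ℂ) : Matrix ο μ ℂ :=
  S₁.transfer s - S₂.transfer s

/-- The induced 2-norm (largest singular value) of a complex matrix, as an extended real. -/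
def specNorm {μ ο : Type*} [Fintype μ] [DecidableEq μ] [Fintype ο] (M : Matrix ο μ ℂ) : ℝ≥0∞ :=
  ‖LinearMap.toContinuousLinearMap (Matrix.toEuclideanLin M)‖ₑ

/-- The `H∞`-norm: the supremum of the induced 2-norm over the open right half-plane. -/
def hInfNorm {μ ο : Type*} [Fintype μ] [DecidableEq μ] [Fintype ο] (G : ℂ → Matrix ο μ ℂ) :
    ℝ≥0∞ :=
  ⨆ s : {s : ℂ // 0 < s.re}, specNorm (G s)

/-- Membership in `H∞`: holomorphic and bounded on the open right half-plane. -/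
def MemHInf {μ ο : Type*} [Fintype μ] [DecidableEq μ] [Fintype ο] (G : ℂ → Matrix ο μ ℂ) : Prop :=
  (∀ i j, DifferentiableOn ℂ (fun s => G s i j) {s : ℂ | 0 < s.re}) ∧ hInfNorm G < ⊤

/-! ### Agents: minimality, passivity, extremal solutions of the KYP inequality -/

/-- Kalman controllability: the ranges of `B, AB, A²B, …` span the state space. -/
def LinSys.Controllable {n m l : ℕ} (S : LinSys (Fin n) (Fin m) (Fin l)) : Prop :=
  (⨆ i : ℕ, LinearMap.range (S.A ^ i * S.B).mulVecLin) = ⊤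

/-- Kalman observability: the kernels of `C, CA, CA², …` meet only in `0`. -/
def LinSys.Observable {n m l : ℕ} (S : LinSys (Fin n) (Fin m) (Fin l)) : Prop :=
  ∀ v : Fin n → ℝ, (∀ i : ℕ, (S.C * S.A ^ i) *ᵥ v = 0) → v = 0

/-- A realization is minimal if it is controllable and observable. -/
def LinSys.Minimal {n m l : ℕ} (S : LinSys (Fin n) (Fin m) (Fin l)) : Prop :=
  S.Controllable ∧ S.Observable

/-- Passivity: there is a nonnegative storage function `V` with
`V (x t₁) - V (x t₀) ≤ ∫ uᵀ y` along all trajectories. -/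
def LinSys.Passive {n m : ℕ} (S : LinSys (Fin n) (Fin m) (Fin m)) : Prop :=
  ∃ V : (Fin n → ℝ) → ℝ, (∀ x, 0 ≤ V x) ∧
    ∀ (x : ℝ → Fin n → ℝ) (u : ℝ → Fin m → ℝ), Continuous u →
      (∀ t, HasDerivAt x (S.A *ᵥ x t + S.B *ᵥ u t) t) →
      ∀ t₀ t₁ : ℝ, t₀ ≤ t₁ →
        V (x t₁) - V (x t₀) ≤ ∫ t in t₀..t₁, u t ⬝ᵥ (S.C *ᵥ x t)

/-- `K` is a symmetric positive definite solution of `Aᵀ K + K A ≤ 0`, `C = Bᵀ K`. -/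
def LinSys.IsKYP {n m : ℕ} (S : LinSys (Fin n) (Fin m) (Fin m))
    (K : Matrix (Fin n) (Fin n) ℝ) : Prop :=
  K.PosDef ∧ (-(S.Aᵀ * K + K * S.A)).PosSemidef ∧ S.C = S.Bᵀ * K

/-- `K` is the minimum (in the Loewner order) of the solutions of the KYP conditions. -/
def LinSys.IsMinKYP {n m : ℕ} (S : LinSys (Fin n) (Fin m) (Fin m))
    (K : Matrix (Fin n) (Fin n) ℝ) : Prop :=
  S.IsKYP K ∧ ∀ K', S.IsKYP K' → (K' - K).PosSemidef

/-- `K` is the maximum (in the Loewner order) of the solutions of the KYP conditions. -/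
def LinSys.IsMaxKYP {n m : ℕ} (S : LinSys (Fin n) (Fin m) (Fin m))
    (K : Matrix (Fin n) (Fin n) ℝ) : Prop :=
  S.IsKYP K ∧ ∀ K', S.IsKYP K' → (K - K').PosSemidef

/-- The same system in the state coordinates `R x`. -/
def LinSys.changeCoords {n m l : ℕ} (S : LinSys (Fin n) (Fin m) (Fin l))
    (R : Matrix (Fin n) (Fin n) ℝ) : LinSys (Fin n) (Fin m) (Fin l) where
  A := R * S.A * R⁻¹
  B := R * S.B
  C := S.C * R⁻¹

/-! ### Weighted graphs and network systems -/

/-- The weights of an undirected connected weighted graph on the nodes `V`; `i ≠ j` are joined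
by an edge when `w i j > 0`. Diagonal weights play no role. -/
structure IsConnectedWeight {V : Type*} (w : V → V → ℝ) : Prop where
  nonneg : ∀ i j, 0 ≤ w i j
  symm : ∀ i j, w i j = w j i
  connected : (SimpleGraph.fromRel fun i j => 0 < w i j).Connected

/-- The Laplacian matrix of a weighted graph. -/
def laplacian {V : Type*} [Fintype V] [DecidableEq V] (w : V → V → ℝ) : Matrix V V ℝ :=
  Matrix.of fun i j => if i = j then ∑ l ∈ Finset.univ.erase i, w i l else -w i j

/-- The network system
`ẋ = (I ⊗ A - L ⊗ B C) x + (F ⊗ B) u`, `y = (H ⊗ C) x`. -/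
def network {n m : ℕ} {V P Q : Type*} [DecidableEq V]
    (S : LinSys (Fin n) (Fin m) (Fin m))
    (L : Matrix V V ℝ) (F : Matrix V P ℝ) (H : Matrix Q V ℝ) :
    LinSys (V × Fin n) (P × Fin m) (Q × Fin m) where
  A := (1 : Matrix V V ℝ) ⊗ₖ S.A - L ⊗ₖ (S.B * S.C)
  B := F ⊗ₖ S.B
  C := H ⊗ₖ S.C

/-- The normalized all-ones column `1_N / √N`. -/
def avgCol (N : ℕ) : Matrix (Fin N) Unit ℝ := Matrix.of fun _ _ => 1 / Real.sqrt N

/-- `L = T diag(Λ, 0) Tᵀ` with `T = [T₁ T₂]` orthogonal, `T₂ = 1_N / √N` and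
`Λ = diag(lam)`, where `lam` is positive and nonincreasing. -/
structure IsSpectralDecomp {N : ℕ} (L : Matrix (Fin N) (Fin N) ℝ)
    (T₁ : Matrix (Fin N) (Fin (N - 1)) ℝ) (lam : Fin (N - 1) → ℝ) : Prop where
  pos : ∀ i, 0 < lam i
  antitone : Antitone lam
  orth : (Matrix.fromCols T₁ (avgCol N))ᵀ * Matrix.fromCols T₁ (avgCol N) = 1
  orth' : Matrix.fromCols T₁ (avgCol N) * (Matrix.fromCols T₁ (avgCol N))ᵀ = 1
  eq : L = Matrix.fromCols T₁ (avgCol N) *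
    Matrix.fromBlocks (Matrix.diagonal lam) 0 0 (0 : Matrix Unit Unit ℝ) *
    (Matrix.fromCols T₁ (avgCol N))ᵀ

/-! ### Gramians, balancing and truncation -/

/-- `X > 0` and `-Λ X - X Λ + F̄ F̄ᵀ = 0`. -/
def IsGraphCtrlGramian {M p : ℕ} (lam : Fin M → ℝ) (Fb : Matrix (Fin M) (Fin p) ℝ)
    (X : Matrix (Fin M) (Fin M) ℝ) : Prop :=
  X.PosDef ∧ -(Matrix.diagonal lam * X) - X * Matrix.diagonal lam + Fb * Fbᵀ = 0

/-- `Y > 0` is block diagonal with respect to the blocks of equal entries of `lam`, and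
`-Λ Y - Y Λ + H̄ᵀ H̄ ≤ 0`. -/
def IsGraphObsGramian {M q : ℕ} (lam : Fin M → ℝ) (Hb : Matrix (Fin q) (Fin M) ℝ)
    (Y : Matrix (Fin M) (Fin M) ℝ) : Prop :=
  Y.PosDef ∧ (∀ i j, lam i ≠ lam j → Y i j = 0) ∧
    (-(-(Matrix.diagonal lam * Y) - Y * Matrix.diagonal lam + Hbᵀ * Hb)).PosSemidef

/-- The nonsingular matrix `T` balances the pair `(P, Q)`:
`T P Tᵀ = T⁻ᵀ Q T⁻¹ = diag(d)` with `d` nonincreasing. -/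
structure IsBalancing {M : ℕ} (T P Q : Matrix (Fin M) (Fin M) ℝ) (d : Fin M → ℝ) : Prop where
  nonsing : IsUnit T.det
  antitone : Antitone d
  ctrl : T * P * Tᵀ = Matrix.diagonal d
  obs : (T⁻¹)ᵀ * Q * T⁻¹ = Matrix.diagonal d

/-- The leading `d × d` block of `T Λ T⁻¹`. -/
def truncLam {M d : ℕ} (h : d ≤ M) (T : Matrix (Fin M) (Fin M) ℝ) (lam : Fin M → ℝ) :
    Matrix (Fin d) (Fin d) ℝ :=
  (T * Matrix.diagonal lam * T⁻¹).submatrix (Fin.castLE h) (Fin.castLE h)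

/-- The first `d` rows of `T F̄`. -/
def truncF {M d p : ℕ} (h : d ≤ M) (T : Matrix (Fin M) (Fin M) ℝ)
    (Fb : Matrix (Fin M) (Fin p) ℝ) : Matrix (Fin d) (Fin p) ℝ :=
  (T * Fb).submatrix (Fin.castLE h) id

/-- The first `d` columns of `H̄ T⁻¹`. -/
def truncH {M d q : ℕ} (h : d ≤ M) (T : Matrix (Fin M) (Fin M) ℝ)
    (Hb : Matrix (Fin q) (Fin M) ℝ) : Matrix (Fin q) (Fin d) ℝ :=
  (Hb * T⁻¹).submatrix id (Fin.castLE h)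

/-- `diag(Λ̂₁, 0)`. -/
def calN {d : ℕ} (Lam₁ : Matrix (Fin d) (Fin d) ℝ) :
    Matrix (Fin d ⊕ Unit) (Fin d ⊕ Unit) ℝ :=
  Matrix.fromBlocks Lam₁ 0 0 0

/-- `F̂₁` stacked on the row `1_Nᵀ F / √N`. -/
def calF {N d p : ℕ} (F₁ : Matrix (Fin d) (Fin p) ℝ) (F : Matrix (Fin N) (Fin p) ℝ) :
    Matrix (Fin d ⊕ Unit) (Fin p) ℝ :=
  Matrix.fromRows F₁ ((avgCol N)ᵀ * F)

/-- `Ĥ₁` followed by the column `H 1_N / √N`. -/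
def calH {N d q : ℕ} (H₁ : Matrix (Fin q) (Fin d) ℝ) (H : Matrix (Fin q) (Fin N) ℝ) :
    Matrix (Fin q) (Fin d ⊕ Unit) ℝ :=
  Matrix.fromCols H₁ (H * avgCol N)

end NetBT

end

namespace NetBT

open Matrix

/-! The orthogonal matrix diagonalizing the Laplacian splits the network into its stable part and
one average agent. The reduced network splits in the same way, and its average agent differs only by
state coordinates, so the two averages cancel in the error transfer function. What remains is a
balanced truncation bound for the stable part.

In the coordinates `TG ⊗ TD` the matrix `diag(σᵢ τⱼ)` is a generalized Gramian on both sides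
(`network_isDiagObsGramian`, `network_isDiagCtrlGramian`). Through `C = Bᵀ K`, the coupling `L ⊗ BC`
contributes the graph Lyapunov expression tensored with `Cᵀ C` (dually `B Bᵀ`), while the agent
contributes its passivity inequality tensored with `diag(σ)`. Both terms are Kronecker products of
semidefinite matrices. Truncating the graph discards exactly the states with `i ≥ k`, for every `j`.

The bound is proved at each `s` with `Re s > 0`, one discarded state at a time
(`IsTruncResponse.one_step`). If `x` and `y` are the responses with and without state `a`, then `x -
y` is tested against the observability inequality and `x + y`, with input `2u`, against the
controllability inequality. The defect at `a` enters with opposite signs, and eliminating it leaves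
an output error of at most `2 dₐ |u|`. Positive Gramians already exclude poles in `Re s > 0`, so no
strict stability is needed. -/

theorem map_ofReal_mulVec_re {ι ο : Type*} [Fintype ι] (A : Matrix ο ι ℝ) (v : ι → ℂ) (i : ο) :
    ((A.map Complex.ofReal *ᵥ v) i).re = (A *ᵥ fun j => (v j).re) i := by
  simp [mulVec, dotProduct, Complex.re_sum]

theorem map_ofReal_mulVec_im {ι ο : Type*} [Fintype ι] (A : Matrix ο ι ℝ) (v : ι → ℂ) (i : ο) :
    ((A.map Complex.ofReal *ᵥ v) i).im = (A *ᵥ fun j => (v j).im) i := by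
  simp [mulVec, dotProduct, Complex.im_sum]

/-! ### Lyapunov inequalities as dissipation inequalities over ℂ -/

section Dissipation

variable {ι μ ο : Type*} [Fintype ι] [Fintype μ] [Fintype ο]

/-- The Lyapunov inequality `Aᵀ D + D A + Cᵀ C ≤ 0`, `D = diag(d)`, as a dissipation inequality. -/
theorem obs_dissipation [DecidableEq ι] {A : Matrix ι ι ℝ} {C : Matrix ο ι ℝ} {d : ι → ℝ}
    (h : (-(Aᵀ * diagonal d + diagonal d * A + Cᵀ * C)).PosSemidef) (v : ι → ℂ) :
    2 * ∑ i, d i * (star (v i) * (A.map Complex.ofReal *ᵥ v) i).re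
      + ∑ o, Complex.normSq ((C.map Complex.ofReal *ᵥ v) o) ≤ 0 := by
  -- All coefficients are real, so both sums at `v` split into their values at `Re v` and `Im v`.
  -- The real case is therefore enough.
  have key (a : ι → ℝ) : 2 * ∑ i, d i * (a i * (A *ᵥ a) i) + ∑ o, (C *ᵥ a) o ^ 2 ≤ 0 := by
    have h1 := h.dotProduct_mulVec_nonneg a
    have e1 : a ⬝ᵥ (Aᵀ *ᵥ (diagonal d *ᵥ a)) = ∑ i, d i * (a i * (A *ᵥ a) i) := by
      rw [dotProduct_mulVec, vecMul_transpose, dotProduct]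
      exact Finset.sum_congr rfl fun i _ => by rw [mulVec_diagonal]; ring
    have e2 : a ⬝ᵥ (diagonal d *ᵥ (A *ᵥ a)) = ∑ i, d i * (a i * (A *ᵥ a) i) := by
      rw [dotProduct]
      exact Finset.sum_congr rfl fun i _ => by rw [mulVec_diagonal]; ring
    have e3 : a ⬝ᵥ (Cᵀ *ᵥ (C *ᵥ a)) = ∑ o, (C *ᵥ a) o ^ 2 := by
      rw [dotProduct_mulVec, vecMul_transpose, dotProduct]
      exact Finset.sum_congr rfl fun i _ => by ring
    simp only [star_trivial, neg_mulVec, add_mulVec, ← mulVec_mulVec, dotProduct_neg,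
      dotProduct_add, e1, e2, e3] at h1
    linarith
  have h1 := key fun j => (v j).re
  have h2 := key fun j => (v j).im
  have e1 (i : ι) : d i * (star (v i) * (A.map Complex.ofReal *ᵥ v) i).re =
      d i * ((v i).re * (A *ᵥ fun j => (v j).re) i)
        + d i * ((v i).im * (A *ᵥ fun j => (v j).im) i) := by
    rw [Complex.mul_re, map_ofReal_mulVec_re, map_ofReal_mulVec_im]
    simp only [Complex.star_def, Complex.conj_re, Complex.conj_im]
    ring
  have e2 (o : ο) : Complex.normSq ((C.map Complex.ofReal *ᵥ v) o) =
      (C *ᵥ fun j => (v j).re) o ^ 2 + (C *ᵥ fun j => (v j).im) o ^ 2 := by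
    rw [Complex.normSq_apply, map_ofReal_mulVec_re, map_ofReal_mulVec_im]
    ring
  simp only [e1, e2, Finset.sum_add_distrib]
  linarith

/-- The Lyapunov inequality `A D + D Aᵀ + B Bᵀ ≤ 0`, `D = diag(d) > 0`, as a dissipation
inequality for the storage function `xᴴ D⁻¹ x`. -/
theorem ctrl_dissipation [DecidableEq ι] {A : Matrix ι ι ℝ} {B : Matrix ι μ ℝ} {d : ι → ℝ}
    (hd : ∀ i, 0 < d i)
    (h : (-(A * diagonal d + diagonal d * Aᵀ + B * Bᵀ)).PosSemidef) (v : ι → ℂ) (u : μ → ℂ) :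
    2 * ∑ i, (d i)⁻¹ * (star (v i) *
      ((A.map Complex.ofReal *ᵥ v) i + (B.map Complex.ofReal *ᵥ u) i)).re
      ≤ ∑ j, Complex.normSq (u j) := by
  have key (a : ι → ℝ) (b : μ → ℝ) :
      2 * ∑ i, (d i)⁻¹ * (a i * ((A *ᵥ a) i + (B *ᵥ b) i)) ≤ ∑ j, b j ^ 2 := by
    -- Testing the inequality at `D⁻¹ a` converts the Gramian `D` into the storage function with
    -- weight `D⁻¹`. The input term is then absorbed by `2pq ≤ p² + q²` with `p = Bᵀ D⁻¹ a`.
    set r : ι → ℝ := fun i => (d i)⁻¹ * a i with hr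
    have hdr : diagonal d *ᵥ r = a := by
      ext i
      rw [mulVec_diagonal, hr]
      exact mul_inv_cancel_left₀ (hd i).ne' _
    have h1 := h.dotProduct_mulVec_nonneg r
    have e1 : r ⬝ᵥ (A *ᵥ a) = ∑ i, (d i)⁻¹ * (a i * (A *ᵥ a) i) := by
      rw [dotProduct]
      exact Finset.sum_congr rfl fun i _ => by rw [hr]; ring
    have e2 : r ⬝ᵥ (diagonal d *ᵥ (Aᵀ *ᵥ r)) = ∑ i, (d i)⁻¹ * (a i * (A *ᵥ a) i) := by
      rw [← e1, dotProduct_mulVec, ← mulVec_transpose, diagonal_transpose, hdr,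
        dotProduct_mulVec, vecMul_transpose, dotProduct_comm]
    have e3 : r ⬝ᵥ (B *ᵥ (Bᵀ *ᵥ r)) = ∑ j, (Bᵀ *ᵥ r) j ^ 2 := by
      rw [dotProduct_mulVec, ← mulVec_transpose, dotProduct]
      exact Finset.sum_congr rfl fun i _ => by ring
    have e4 : ∑ i, (d i)⁻¹ * (a i * (B *ᵥ b) i) = ∑ j, (Bᵀ *ᵥ r) j * b j := by
      have : r ⬝ᵥ (B *ᵥ b) = (Bᵀ *ᵥ r) ⬝ᵥ b := by rw [dotProduct_mulVec, ← mulVec_transpose]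
      simp only [dotProduct] at this
      rw [← this]
      exact Finset.sum_congr rfl fun i _ => by rw [hr]; ring
    simp only [star_trivial, neg_mulVec, add_mulVec, ← mulVec_mulVec, dotProduct_neg,
      dotProduct_add, hdr, e1, e2, e3] at h1
    have h2 : 2 * ∑ j, (Bᵀ *ᵥ r) j * b j ≤ ∑ j, (Bᵀ *ᵥ r) j ^ 2 + ∑ j, b j ^ 2 := by
      rw [Finset.mul_sum, ← Finset.sum_add_distrib]
      exact Finset.sum_le_sum fun j _ => by nlinarith [sq_nonneg ((Bᵀ *ᵥ r) j - b j)]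
    simp only [mul_add, Finset.sum_add_distrib, e4]
    linarith
  have h1 := key (fun j => (v j).re) (fun j => (u j).re)
  have h2 := key (fun j => (v j).im) (fun j => (u j).im)
  have e1 (i : ι) : (d i)⁻¹ * (star (v i) *
      ((A.map Complex.ofReal *ᵥ v) i + (B.map Complex.ofReal *ᵥ u) i)).re =
      (d i)⁻¹ * ((v i).re * ((A *ᵥ fun j => (v j).re) i + (B *ᵥ fun j => (u j).re) i))
        + (d i)⁻¹ * ((v i).im * ((A *ᵥ fun j => (v j).im) i + (B *ᵥ fun j => (u j).im) i)) := by
    rw [Complex.mul_re, Complex.add_re, Complex.add_im, map_ofReal_mulVec_re,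
      map_ofReal_mulVec_im, map_ofReal_mulVec_re, map_ofReal_mulVec_im]
    simp only [Complex.star_def, Complex.conj_re, Complex.conj_im]
    ring
  have e2 (j : μ) : Complex.normSq (u j) = (u j).re ^ 2 + (u j).im ^ 2 := by
    rw [Complex.normSq_apply]
    ring
  simp only [e1, e2, Finset.sum_add_distrib]
  linarith

end Dissipation

/-! ### Removing states one at a time at a fixed frequency -/

section Truncation

variable {ι μ ο : Type*} [Fintype ι] [DecidableEq ι] [Fintype μ] [Fintype ο]

/-- `x` is the state response at the frequency `s` to the input `u` of the truncation of
`(A, B)` to the states in `S`, extended by zero. -/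
structure IsTruncResponse (A : Matrix ι ι ℂ) (B : Matrix ι μ ℂ) (s : ℂ) (u : μ → ℂ)
    (S : Finset ι) (x : ι → ℂ) : Prop where
  supp : ∀ i, i ∉ S → x i = 0
  eqn : ∀ i ∈ S, s * x i = (A *ᵥ x) i + (B *ᵥ u) i

theorem re_star_mul_mul_self (s z : ℂ) : (star z * (s * z)).re = s.re * Complex.normSq z := by
  simp only [Complex.star_def, Complex.mul_re, Complex.mul_im, Complex.conj_re, Complex.conj_im,
    Complex.normSq_apply]
  ring

/-- Pairing the equation with `d i * star (x i)` gives `Re s · ∑ dᵢ |xᵢ|² ≤ 0`. Indices outside `S`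
contribute nothing because `x` vanishes there, so dissipativity of the full matrix suffices for
every truncation. -/
theorem eq_zero_of_trunc_homogeneous {A : Matrix ι ι ℂ} {d : ι → ℝ} (hd : ∀ i, 0 < d i)
    (hA : ∀ v : ι → ℂ, ∑ i, d i * (star (v i) * (A *ᵥ v) i).re ≤ 0)
    {s : ℂ} (hs : 0 < s.re) {S : Finset ι} {x : ι → ℂ} (hsupp : ∀ i, i ∉ S → x i = 0)
    (heqn : ∀ i ∈ S, s * x i = (A *ᵥ x) i) : x = 0 := by
  have h0 (i : ι) : d i * (star (x i) * (A *ᵥ x) i).re = s.re * (d i * Complex.normSq (x i)) := by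
    by_cases hi : i ∈ S
    · rw [← heqn i hi, re_star_mul_mul_self]
      ring
    · simp [hsupp i hi]
  have h1 := hA x
  simp only [h0, ← Finset.mul_sum] at h1
  have hnn : ∀ i ∈ Finset.univ, 0 ≤ d i * Complex.normSq (x i) :=
    fun i _ => mul_nonneg (hd i).le (Complex.normSq_nonneg _)
  have h2 := le_antisymm (nonpos_of_mul_nonpos_right h1 hs) (Finset.sum_nonneg hnn)
  ext i
  have h3 := (Finset.sum_eq_zero_iff_of_nonneg hnn).1 h2 i (Finset.mem_univ i)
  exact Complex.normSq_eq_zero.1 ((mul_eq_zero.1 h3).resolve_left (hd i).ne')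

/-- The state equations on `S` and the conditions `x i = 0` off `S` form one square linear system.
It is injective by the energy argument, hence surjective. -/
theorem exists_isTruncResponse {A : Matrix ι ι ℂ} {d : ι → ℝ} (hd : ∀ i, 0 < d i)
    (hA : ∀ v : ι → ℂ, ∑ i, d i * (star (v i) * (A *ᵥ v) i).re ≤ 0)
    (B : Matrix ι μ ℂ) {s : ℂ} (hs : 0 < s.re) (u : μ → ℂ) (S : Finset ι) :
    ∃ x, IsTruncResponse A B s u S x := by
  let f : (ι → ℂ) →ₗ[ℂ] (ι → ℂ) :=
    { toFun := fun x i => if i ∈ S then s * x i - (A *ᵥ x) i else x i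
      map_add' := fun x y => by
        ext i
        simp only [mulVec_add, Pi.add_apply]
        split_ifs <;> ring
      map_smul' := fun c x => by
        ext i
        simp only [mulVec_smul, Pi.smul_apply, smul_eq_mul, RingHom.id_apply]
        split_ifs <;> ring }
  have hf (x : ι → ℂ) (i : ι) : f x i = if i ∈ S then s * x i - (A *ᵥ x) i else x i := rfl
  have hinj : Function.Injective f := by
    rw [injective_iff_map_eq_zero]
    intro x hx
    have hx' (i : ι) : (if i ∈ S then s * x i - (A *ᵥ x) i else x i) = 0 := by
      rw [← hf, hx, Pi.zero_apply]
    refine eq_zero_of_trunc_homogeneous (S := S) hd hA hs (fun i hi => ?_) fun i hi => ?_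
    · have := hx' i
      rwa [if_neg hi] at this
    · have := hx' i
      rwa [if_pos hi, sub_eq_zero] at this
  obtain ⟨x, hx⟩ := LinearMap.surjective_of_injective hinj
    fun i => if i ∈ S then (B *ᵥ u) i else 0
  refine ⟨x, fun i hi => ?_, fun i hi => ?_⟩
  · have := congrFun hx i
    rwa [hf, if_neg hi, if_neg hi] at this
  · have := congrFun hx i
    rw [hf, if_pos hi, if_pos hi] at this
    rw [← this]
    ring

/-- Removing one state `a` of a balanced system changes the output by at most `2 dₐ |u|`. -/
theorem IsTruncResponse.one_step {A : Matrix ι ι ℂ} {B : Matrix ι μ ℂ} {C : Matrix ο ι ℂ}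
    {d : ι → ℝ} (hd : ∀ i, 0 < d i)
    (hobs : ∀ v : ι → ℂ, 2 * ∑ i, d i * (star (v i) * (A *ᵥ v) i).re
      + ∑ o, Complex.normSq ((C *ᵥ v) o) ≤ 0)
    (hctrl : ∀ (v : ι → ℂ) (u : μ → ℂ), 2 * ∑ i, (d i)⁻¹ * (star (v i) *
      ((A *ᵥ v) i + (B *ᵥ u) i)).re ≤ ∑ j, Complex.normSq (u j))
    {s : ℂ} (hs : 0 < s.re) {u : μ → ℂ} {S : Finset ι} {a : ι} (ha : a ∉ S) {x y : ι → ℂ}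
    (hx : IsTruncResponse A B s u (insert a S) x) (hy : IsTruncResponse A B s u S y) :
    ∑ o, Complex.normSq ((C *ᵥ x) o - (C *ᵥ y) o) ≤
      (2 * d a) ^ 2 * ∑ j, Complex.normSq (u j) := by
  -- `W` is the amount by which `y`, with `y a = 0`, fails the equation of the removed state `a`.
  set W : ℂ := (A *ᵥ y) a + (B *ᵥ u) a with hW
  have hya : y a = 0 := hy.supp a ha
  have hxa := hx.eqn a (Finset.mem_insert_self a S)
  have hzero (i : ι) (hia : i ≠ a) (hi : i ∉ S) : x i = 0 ∧ y i = 0 :=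
    ⟨hx.supp i (by simp [hia, hi]), hy.supp i hi⟩
  -- The input cancels in `x - y` and doubles in `x + y`. Both have `a`-entry `x a`, while their
  -- defects at `a` are `-W` and `+W`.
  have h1 := hobs (x - y)
  have h2 := hctrl (x + y) ((2 : ℂ) • u)
  have e1 (i : ι) : d i * (star ((x - y) i) * (A *ᵥ (x - y)) i).re =
      s.re * (d i * Complex.normSq ((x - y) i)) - if i = a then d a * (star (x a) * W).re else 0 := by
    by_cases hia : i = a
    · subst hia
      have : (A *ᵥ (x - y)) i = s * (x - y) i - W := by
        rw [mulVec_sub, Pi.sub_apply, Pi.sub_apply, hya, hW, sub_zero, hxa]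
        ring
      rw [this, if_pos rfl, mul_sub, Complex.sub_re, re_star_mul_mul_self, Pi.sub_apply, hya,
        sub_zero]
      ring
    · rw [if_neg hia]
      by_cases hi : i ∈ S
      · have : (A *ᵥ (x - y)) i = s * (x - y) i := by
          rw [mulVec_sub, Pi.sub_apply, Pi.sub_apply, mul_sub,
            hx.eqn i (Finset.mem_insert_of_mem hi), hy.eqn i hi]
          ring
        rw [this, re_star_mul_mul_self]
        ring
      · obtain ⟨h, h'⟩ := hzero i hia hi
        simp [h, h']
  have e2 (i : ι) : (d i)⁻¹ * (star ((x + y) i) *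
      ((A *ᵥ (x + y)) i + (B *ᵥ ((2 : ℂ) • u)) i)).re =
      s.re * ((d i)⁻¹ * Complex.normSq ((x + y) i))
        + if i = a then (d a)⁻¹ * (star (x a) * W).re else 0 := by
    by_cases hia : i = a
    · subst hia
      have : (A *ᵥ (x + y)) i + (B *ᵥ ((2 : ℂ) • u)) i = s * (x + y) i + W := by
        rw [mulVec_add, mulVec_smul, Pi.add_apply, Pi.add_apply, Pi.smul_apply, smul_eq_mul, hya,
          hW, add_zero, hxa]
        ring
      rw [this, if_pos rfl, mul_add, Complex.add_re, re_star_mul_mul_self, Pi.add_apply, hya,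
        add_zero]
      ring
    · rw [if_neg hia]
      by_cases hi : i ∈ S
      · have : (A *ᵥ (x + y)) i + (B *ᵥ ((2 : ℂ) • u)) i = s * (x + y) i := by
          rw [mulVec_add, mulVec_smul, Pi.add_apply, Pi.add_apply, Pi.smul_apply, smul_eq_mul,
            mul_add, hx.eqn i (Finset.mem_insert_of_mem hi), hy.eqn i hi]
          ring
        rw [this, re_star_mul_mul_self]
        ring
      · obtain ⟨h, h'⟩ := hzero i hia hi
        simp [h, h']
  have e3 (j : μ) : Complex.normSq (((2 : ℂ) • u) j) = 4 * Complex.normSq (u j) := by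
    rw [Pi.smul_apply, smul_eq_mul, map_mul]
    norm_num [Complex.normSq_apply]
  simp only [e1, Finset.sum_sub_distrib, Finset.sum_ite_eq', Finset.mem_univ, if_true,
    ← Finset.mul_sum] at h1
  simp only [e2, e3, Finset.sum_add_distrib, Finset.sum_ite_eq', Finset.mem_univ, if_true,
    ← Finset.mul_sum] at h2
  have p1 : 0 ≤ s.re * ∑ i, d i * Complex.normSq ((x - y) i) :=
    mul_nonneg hs.le (Finset.sum_nonneg fun i _ => mul_nonneg (hd i).le (Complex.normSq_nonneg _))
  have p2 : 0 ≤ s.re * ∑ i, (d i)⁻¹ * Complex.normSq ((x + y) i) :=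
    mul_nonneg hs.le (Finset.sum_nonneg fun i _ =>
      mul_nonneg (inv_nonneg.2 (hd i).le) (Complex.normSq_nonneg _))
  have h3 : (d a)⁻¹ * (star (x a) * W).re ≤ 2 * ∑ j, Complex.normSq (u j) := by linarith
  -- The defect has weight `d a` in one inequality and `(d a)⁻¹` in the other. Scaling the second by
  -- `(d a)²` lets it be eliminated and produces the constant `(2 * d a) ^ 2`.
  have h4 := mul_le_mul_of_nonneg_left h3 (mul_nonneg (hd a).le (hd a).le)
  have h5 : d a * d a * ((d a)⁻¹ * (star (x a) * W).re) = d a * (star (x a) * W).re := by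
    field_simp [(hd a).ne']
  simp only [mulVec_sub, Pi.sub_apply] at h1
  rw [h5] at h4
  simp only [Pi.sub_apply] at p1
  linarith

/-- Removing the states in `R` of a balanced system changes the output by at most
`2 (∑ i ∈ R, dᵢ) |u|`. -/
theorem IsTruncResponse.norm_sub_le {A : Matrix ι ι ℂ} {B : Matrix ι μ ℂ} {C : Matrix ο ι ℂ}
    {d : ι → ℝ} (hd : ∀ i, 0 < d i)
    (hobs : ∀ v : ι → ℂ, 2 * ∑ i, d i * (star (v i) * (A *ᵥ v) i).re
      + ∑ o, Complex.normSq ((C *ᵥ v) o) ≤ 0)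
    (hctrl : ∀ (v : ι → ℂ) (u : μ → ℂ), 2 * ∑ i, (d i)⁻¹ * (star (v i) *
      ((A *ᵥ v) i + (B *ᵥ u) i)).re ≤ ∑ j, Complex.normSq (u j))
    {s : ℂ} (hs : 0 < s.re) {u : μ → ℂ} {S R : Finset ι} (hSR : Disjoint S R) {x y : ι → ℂ}
    (hx : IsTruncResponse A B s u (S ∪ R) x) (hy : IsTruncResponse A B s u S y) :
    ‖WithLp.toLp 2 (C *ᵥ x) - WithLp.toLp 2 (C *ᵥ y)‖ ≤
      2 * (∑ i ∈ R, d i) * ‖WithLp.toLp 2 u‖ := by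
  have step {S : Finset ι} {a : ι} (ha : a ∉ S) {x y : ι → ℂ}
      (hx : IsTruncResponse A B s u (insert a S) x) (hy : IsTruncResponse A B s u S y) :
      ‖WithLp.toLp 2 (C *ᵥ x) - WithLp.toLp 2 (C *ᵥ y)‖ ≤ 2 * d a * ‖WithLp.toLp 2 u‖ := by
    refine le_of_sq_le_sq ?_ (mul_nonneg (mul_nonneg zero_le_two (hd a).le) (norm_nonneg _))
    rw [mul_pow, EuclideanSpace.norm_sq_eq, EuclideanSpace.norm_sq_eq]
    simpa only [Complex.normSq_eq_norm_sq, PiLp.sub_apply] using hx.one_step hd hobs hctrl hs ha hy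
  have hA (v : ι → ℂ) : ∑ i, d i * (star (v i) * (A *ᵥ v) i).re ≤ 0 := by
    have h1 := hobs v
    have h2 : 0 ≤ ∑ o, Complex.normSq ((C *ᵥ v) o) :=
      Finset.sum_nonneg fun _ _ => Complex.normSq_nonneg _
    linarith
  -- States may leave in any order: each intermediate response, extended by zero, is tested in the
  -- inequalities of the full system. The base case is uniqueness of the truncated response, and the
  -- step is the triangle inequality.
  induction R using Finset.induction_on generalizing x with
  | empty =>
    rw [Finset.union_empty] at hx
    have hxy : x - y = 0 := eq_zero_of_trunc_homogeneous hd hA hs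
      (fun i hi => by simp [hx.supp i hi, hy.supp i hi]) fun i hi => by
        rw [mulVec_sub, Pi.sub_apply, Pi.sub_apply, mul_sub, hx.eqn i hi, hy.eqn i hi]
        ring
    simp [sub_eq_zero.1 hxy]
  | insert a R haR ih =>
    rw [Finset.disjoint_insert_right] at hSR
    obtain ⟨z, hz⟩ := exists_isTruncResponse hd hA B hs u (S ∪ R)
    have h1 := ih hSR.2 hz
    have ha : a ∉ S ∪ R := by simp [hSR.1, haR]
    rw [Finset.union_insert] at hx
    have h2 := step ha hx hz
    rw [Finset.sum_insert haR]
    calc _ ≤ _ := norm_sub_le_norm_sub_add_norm_sub _ (WithLp.toLp 2 (C *ᵥ z)) _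
      _ ≤ _ := add_le_add h2 h1
      _ = _ := by ring

end Truncation

/-! ### Frequency responses and invariance under state coordinates -/

section Transfer

variable {ι κ μ ο : Type*} [Fintype ι] [DecidableEq ι] [Fintype κ] [DecidableEq κ]

theorem map_ofReal_mul {l m n : Type*} [Fintype m] (M : Matrix l m ℝ) (N : Matrix m n ℝ) :
    (M * N).map Complex.ofReal = M.map Complex.ofReal * N.map Complex.ofReal :=
  Matrix.map_mul (f := Complex.ofRealHom)

theorem map_ofReal_one {ι : Type*} [DecidableEq ι] : (1 : Matrix ι ι ℝ).map Complex.ofReal = 1 :=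
  Matrix.map_one _ Complex.ofReal_zero Complex.ofReal_one

/-- The point `s` is not a pole of the resolvent of the state matrix. -/
def LinSys.Regular (S : LinSys ι μ ο) (s : ℂ) : Prop :=
  IsUnit (s • (1 : Matrix ι ι ℂ) - S.A.map Complex.ofReal).det

theorem pencil_mulVec_apply (A : Matrix ι ι ℂ) (s : ℂ) (v : ι → ℂ) (i : ι) :
    ((s • (1 : Matrix ι ι ℂ) - A) *ᵥ v) i = s * v i - (A *ᵥ v) i := by
  rw [sub_mulVec, smul_mulVec, one_mulVec, Pi.sub_apply, Pi.smul_apply, smul_eq_mul]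

theorem LinSys.regular_of_forall {S : LinSys ι μ ο} {s : ℂ}
    (h : ∀ v : ι → ℂ, (∀ i, s * v i = (S.A.map Complex.ofReal *ᵥ v) i) → v = 0) :
    S.Regular s := by
  rw [LinSys.Regular, isUnit_iff_ne_zero]
  intro h0
  obtain ⟨v, hv, hv0⟩ := exists_mulVec_eq_zero_iff.2 h0
  refine hv (h v fun i => ?_)
  rw [← sub_eq_zero, ← pencil_mulVec_apply, hv0, Pi.zero_apply]

theorem LinSys.Regular.eq_zero_of_homogeneous {S : LinSys ι μ ο} {s : ℂ} (h : S.Regular s)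
    {v : ι → ℂ} (hv : ∀ i, s * v i = (S.A.map Complex.ofReal *ᵥ v) i) : v = 0 := by
  by_contra h0
  refine h.ne_zero (exists_mulVec_eq_zero_iff.1 ⟨v, h0, ?_⟩)
  ext i
  rw [pencil_mulVec_apply, hv, sub_self, Pi.zero_apply]

variable [Fintype μ]

theorem LinSys.Regular.exists_response {S : LinSys ι μ ο} {s : ℂ} (h : S.Regular s) (u : μ → ℂ) :
    ∃ x : ι → ℂ, ∀ i, s * x i =
      (S.A.map Complex.ofReal *ᵥ x) i + (S.B.map Complex.ofReal *ᵥ u) i := by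
  refine ⟨(s • (1 : Matrix ι ι ℂ) - S.A.map Complex.ofReal)⁻¹ *ᵥ
    (S.B.map Complex.ofReal *ᵥ u), fun i => ?_⟩
  rw [← sub_eq_iff_eq_add', ← pencil_mulVec_apply, mulVec_mulVec, mul_nonsing_inv _ h, one_mulVec]

theorem LinSys.Regular.transfer_mulVec {S : LinSys ι μ ο} {s : ℂ} (h : S.Regular s) {u : μ → ℂ}
    {x : ι → ℂ} (hx : ∀ i, s * x i =
      (S.A.map Complex.ofReal *ᵥ x) i + (S.B.map Complex.ofReal *ᵥ u) i) :
    S.transfer s *ᵥ u = S.C.map Complex.ofReal *ᵥ x := by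
  have hx' : (s • (1 : Matrix ι ι ℂ) - S.A.map Complex.ofReal) *ᵥ x =
      S.B.map Complex.ofReal *ᵥ u := by
    ext i
    rw [pencil_mulVec_apply, hx i, add_sub_cancel_left]
  rw [LinSys.transfer, ← mulVec_mulVec, ← hx', mulVec_mulVec, nonsing_inv_mul_cancel_right _ _ h]

omit [Fintype μ] in
/-- Two realizations that differ by a change of state coordinates. -/
structure LinSys.Similar (S₁ : LinSys ι μ ο) (S₂ : LinSys κ μ ο) (T : Matrix κ ι ℝ)
    (T' : Matrix ι κ ℝ) : Prop where
  right_inv : T * T' = 1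
  left_inv : T' * T = 1
  A_eq : S₂.A = T * S₁.A * T'
  B_eq : S₂.B = T * S₁.B
  C_eq : S₂.C = S₁.C * T'

omit [Fintype μ] in
theorem LinSys.Similar.symm {S₁ : LinSys ι μ ο} {S₂ : LinSys κ μ ο} {T : Matrix κ ι ℝ}
    {T' : Matrix ι κ ℝ} (h : S₁.Similar S₂ T T') : S₂.Similar S₁ T' T where
  right_inv := h.left_inv
  left_inv := h.right_inv
  A_eq := by
    rw [h.A_eq, Matrix.mul_assoc T, ← Matrix.mul_assoc T', h.left_inv, Matrix.one_mul,
      Matrix.mul_assoc, h.left_inv, Matrix.mul_one]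
  B_eq := by rw [h.B_eq, ← Matrix.mul_assoc, h.left_inv, Matrix.one_mul]
  C_eq := by rw [h.C_eq, Matrix.mul_assoc, h.left_inv, Matrix.mul_one]

-- An explicit right inverse of the transformed pencil yields both its regularity and the equality
-- of transfer functions, even when the two realizations have different state index types.
omit [Fintype μ] in
theorem LinSys.Similar.pencil_mul {S₁ : LinSys ι μ ο} {S₂ : LinSys κ μ ο} {T : Matrix κ ι ℝ}
    {T' : Matrix ι κ ℝ} (h : S₁.Similar S₂ T T') {s : ℂ} (hs : S₁.Regular s) :
    (s • (1 : Matrix κ κ ℂ) - S₂.A.map Complex.ofReal) *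
      (T.map Complex.ofReal * (s • (1 : Matrix ι ι ℂ) - S₁.A.map Complex.ofReal)⁻¹ *
        T'.map Complex.ofReal) = 1 := by
  have h1 : T.map Complex.ofReal * T'.map Complex.ofReal = 1 := by
    rw [← map_ofReal_mul, h.right_inv, map_ofReal_one]
  have h2 : T'.map Complex.ofReal * T.map Complex.ofReal = 1 := by
    rw [← map_ofReal_mul, h.left_inv, map_ofReal_one]
  have h3 : s • (1 : Matrix κ κ ℂ) - S₂.A.map Complex.ofReal =
      T.map Complex.ofReal * (s • (1 : Matrix ι ι ℂ) - S₁.A.map Complex.ofReal) *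
        T'.map Complex.ofReal := by
    rw [h.A_eq, map_ofReal_mul, map_ofReal_mul, Matrix.mul_sub, Matrix.sub_mul, Matrix.mul_smul,
      Matrix.mul_one, Matrix.smul_mul, h1]
  rw [h3, Matrix.mul_assoc, Matrix.mul_assoc, ← Matrix.mul_assoc (T'.map _),
    ← Matrix.mul_assoc (T'.map _), h2, Matrix.one_mul,
    ← Matrix.mul_assoc (s • (1 : Matrix ι ι ℂ) - _), mul_nonsing_inv _ hs, Matrix.one_mul, h1]

omit [Fintype μ] in
theorem LinSys.Similar.regular {S₁ : LinSys ι μ ο} {S₂ : LinSys κ μ ο} {T : Matrix κ ι ℝ}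
    {T' : Matrix ι κ ℝ} (h : S₁.Similar S₂ T T') {s : ℂ} (hs : S₁.Regular s) : S₂.Regular s :=
  isUnit_det_of_right_inverse (h.pencil_mul hs)

omit [Fintype μ] in
theorem LinSys.Similar.transfer_eq {S₁ : LinSys ι μ ο} {S₂ : LinSys κ μ ο} {T : Matrix κ ι ℝ}
    {T' : Matrix ι κ ℝ} (h : S₁.Similar S₂ T T') {s : ℂ} (hs : S₁.Regular s) :
    S₂.transfer s = S₁.transfer s := by
  have h2 : T'.map Complex.ofReal * T.map Complex.ofReal = 1 := by
    rw [← map_ofReal_mul, h.left_inv, map_ofReal_one]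
  rw [LinSys.transfer, LinSys.transfer, inv_eq_right_inv (h.pencil_mul hs), h.B_eq, h.C_eq,
    map_ofReal_mul, map_ofReal_mul]
  simp only [Matrix.mul_assoc]
  rw [← Matrix.mul_assoc (T'.map _) (T.map _), h2, Matrix.one_mul,
    ← Matrix.mul_assoc (T'.map _) (T.map _), h2, Matrix.one_mul]

end Transfer

/-! ### Holomorphy of transfer functions -/

section Holomorphy

variable {ι μ ο : Type*} [Fintype ι] [DecidableEq ι]

theorem differentiable_det {M : ℂ → Matrix ι ι ℂ}
    (hM : ∀ i j, Differentiable ℂ fun s => M s i j) : Differentiable ℂ fun s => (M s).det := by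
  simp only [det_apply]
  refine Differentiable.fun_sum fun σ _ => Differentiable.const_smul ?_ _
  exact Differentiable.fun_finsetProd fun i _ => hM _ _

theorem differentiable_adjugate {M : ℂ → Matrix ι ι ℂ}
    (hM : ∀ i j, Differentiable ℂ fun s => M s i j) (i j : ι) :
    Differentiable ℂ fun s => (M s).adjugate i j := by
  simp only [adjugate_apply]
  refine differentiable_det fun a b => ?_
  by_cases h : a = j
  · subst h
    simp
  · simpa [updateRow_ne h] using hM a b

/-- By Cramer's rule the resolvent is the adjugate divided by the determinant. Both are polynomial
in `s`, and the determinant does not vanish at regular points. -/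
theorem LinSys.differentiableOn_transfer (S : LinSys ι μ ο) {U : Set ℂ}
    (hU : ∀ s ∈ U, S.Regular s) (i : ο) (j : μ) :
    DifferentiableOn ℂ (fun s => S.transfer s i j) U := by
  have hM (a b : ι) :
      Differentiable ℂ fun s : ℂ => (s • (1 : Matrix ι ι ℂ) - S.A.map Complex.ofReal) a b := by
    simp only [Matrix.sub_apply, Matrix.smul_apply, smul_eq_mul]
    fun_prop
  have hinv (a b : ι) : DifferentiableOn ℂ
      (fun s : ℂ => (s • (1 : Matrix ι ι ℂ) - S.A.map Complex.ofReal)⁻¹ a b) U := by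
    simp only [inv_def, Matrix.smul_apply, smul_eq_mul, Ring.inverse_eq_inv']
    exact ((differentiable_det hM).differentiableOn.inv fun s hs => (hU s hs).ne_zero).mul
      (differentiable_adjugate hM a b).differentiableOn
  simp only [LinSys.transfer, mul_apply]
  refine DifferentiableOn.fun_sum fun b _ => DifferentiableOn.mul_const ?_ _
  exact DifferentiableOn.fun_sum fun a _ => (hinv a b).const_mul _

end Holomorphy

/-! ### Balanced truncation with generalized Gramians -/

section BalancedTruncation

variable {ι κ μ ο : Type*} [Fintype ι] [DecidableEq ι] [Fintype κ] [DecidableEq κ]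
  [Fintype μ] [DecidableEq μ] [Fintype ο]

/-- The truncation of a system to the states in the range of `e`. -/
def LinSys.truncate (S : LinSys ι μ ο) (e : κ → ι) : LinSys κ μ ο where
  A := S.A.submatrix e e
  B := S.B.submatrix e id
  C := S.C.submatrix id e

/-- `diag(d)` is an observability Gramian in the generalized (inequality) sense. -/
def LinSys.IsDiagObsGramian (S : LinSys ι μ ο) (d : ι → ℝ) : Prop :=
  (-(S.Aᵀ * diagonal d + diagonal d * S.A + S.Cᵀ * S.C)).PosSemidef

/-- `diag(d)` is a controllability Gramian in the generalized (inequality) sense. -/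
def LinSys.IsDiagCtrlGramian (S : LinSys ι μ ο) (d : ι → ℝ) : Prop :=
  (-(S.A * diagonal d + diagonal d * S.Aᵀ + S.B * S.Bᵀ)).PosSemidef

omit [Fintype μ] [DecidableEq μ] in
theorem LinSys.IsDiagObsGramian.dissipative {S : LinSys ι μ ο} {d : ι → ℝ}
    (h : S.IsDiagObsGramian d) (v : ι → ℂ) :
    ∑ i, d i * (star (v i) * (S.A.map Complex.ofReal *ᵥ v) i).re ≤ 0 := by
  have h1 := obs_dissipation h v
  have h2 : 0 ≤ ∑ o, Complex.normSq ((S.C.map Complex.ofReal *ᵥ v) o) :=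
    Finset.sum_nonneg fun _ _ => Complex.normSq_nonneg _
  linarith

omit [Fintype μ] [DecidableEq μ] in
theorem LinSys.IsDiagObsGramian.regular {S : LinSys ι μ ο} {d : ι → ℝ}
    (h : S.IsDiagObsGramian d) (hd : ∀ i, 0 < d i) {s : ℂ} (hs : 0 < s.re) : S.Regular s :=
  LinSys.regular_of_forall fun _ hv =>
    eq_zero_of_trunc_homogeneous (S := Finset.univ) hd h.dissipative hs
      (fun i hi => absurd (Finset.mem_univ i) hi) fun i _ => hv i

-- Because the Gramian is diagonal, the Lyapunov expression of the truncation is a principal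
-- submatrix of the full one.
omit [Fintype μ] [DecidableEq μ] in
theorem LinSys.IsDiagObsGramian.truncate {S : LinSys ι μ ο} {d : ι → ℝ}
    (h : S.IsDiagObsGramian d) (e : κ → ι) :
    (S.truncate e).IsDiagObsGramian (d ∘ e) := by
  have h1 := PosSemidef.submatrix h e
  rw [LinSys.IsDiagObsGramian]
  convert h1 using 1
  ext i j
  simp only [LinSys.truncate, Matrix.neg_apply, Matrix.add_apply, mul_diagonal, diagonal_mul,
    submatrix_apply, transpose_apply, Function.comp_apply]
  rfl

theorem specNorm_le_ofReal {M : Matrix ο μ ℂ} {c : ℝ} (hc : 0 ≤ c)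
    (h : ∀ u : μ → ℂ, ‖WithLp.toLp 2 (M *ᵥ u)‖ ≤ c * ‖WithLp.toLp 2 u‖) :
    specNorm M ≤ ENNReal.ofReal c := by
  rw [specNorm, ← ofReal_norm]
  refine ENNReal.ofReal_le_ofReal (ContinuousLinearMap.opNorm_le_bound _ hc fun x => ?_)
  exact h x.ofLp

/-- The error bound of balanced truncation, for generalized Gramians. -/
theorem LinSys.specNorm_sub_truncate_le {S : LinSys ι μ ο} {d : ι → ℝ} (hd : ∀ i, 0 < d i)
    (hobs : S.IsDiagObsGramian d) (hctrl : S.IsDiagCtrlGramian d) {e : κ → ι}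
    (he : Function.Injective e) {R : Finset ι} (hR : ∀ i, i ∈ R ↔ i ∉ Set.range e)
    {s : ℂ} (hs : 0 < s.re) :
    specNorm (S.transfer s - (S.truncate e).transfer s) ≤ ENNReal.ofReal (2 * ∑ i ∈ R, d i) := by
  refine specNorm_le_ofReal
    (mul_nonneg zero_le_two (Finset.sum_nonneg fun i _ => (hd i).le)) fun u => ?_
  have hreg := hobs.regular hd hs
  have hreg' := (hobs.truncate e).regular (fun i => hd (e i)) hs
  obtain ⟨x, hx⟩ := hreg.exists_response u
  obtain ⟨y, hy⟩ := hreg'.exists_response u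
  -- Zero extension turns the response of the truncated system into a response supported on `Rᶜ` for
  -- the full matrices.
  have hext (r : ι → ℂ) : r ⬝ᵥ Function.extend e y 0 = (r ∘ e) ⬝ᵥ y := by
    refine (Fintype.sum_of_injective e he _ _ (fun i hi => ?_) fun k => ?_).symm
    · rw [Function.extend_apply' _ _ _ (by simpa using hi), Pi.zero_apply, mul_zero]
    · rw [he.extend_apply, Function.comp_apply]
  rw [sub_mulVec, hreg.transfer_mulVec hx, hreg'.transfer_mulVec hy]
  have hC : (S.truncate e).C.map Complex.ofReal *ᵥ y =
      S.C.map Complex.ofReal *ᵥ Function.extend e y 0 := by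
    ext o
    exact (hext (S.C.map Complex.ofReal o)).symm
  rw [hC]
  have hdisj : Disjoint Rᶜ R := disjoint_compl_left
  refine IsTruncResponse.norm_sub_le (A := S.A.map Complex.ofReal) (B := S.B.map Complex.ofReal)
    (s := s) hd (obs_dissipation hobs) (ctrl_dissipation hd hctrl) hs hdisj
    ⟨fun i hi => ?_, fun i _ => hx i⟩ ⟨fun i hi => ?_, fun i hi => ?_⟩
  · exact absurd (by rw [Finset.union_comm, Finset.union_compl]; exact Finset.mem_univ i) hi
  · rw [Finset.mem_compl, not_not, hR] at hi
    rw [Function.extend_apply' _ _ _ (by simpa using hi), Pi.zero_apply]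
  · rw [Finset.mem_compl, hR, not_not] at hi
    obtain ⟨k, rfl⟩ := hi
    rw [he.extend_apply, hy k]
    exact congrArg (· + _) (hext (S.A.map Complex.ofReal (e k))).symm

end BalancedTruncation

/-! ### Kronecker Gramians, coordinate changes and parallel connection of networks -/

section Network

variable {n m : ℕ} {V W P Q : Type*} [Fintype V] [DecidableEq V] [Fintype W] [DecidableEq W]

/-- Since `C = Bᵀ D` with `D = diag(τ)`, both `D B C` and its transpose equal `Cᵀ C`. Hence the
negated Lyapunov expression is `diag(σ) ⊗ -(Aᵀ D + D A)` plus `(Mᵀ Σ + Σ M - Hᵀ H) ⊗ Cᵀ C`, where `Σ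
= diag(σ)`. -/
theorem network_isDiagObsGramian [Fintype Q] {S : LinSys (Fin n) (Fin m) (Fin m)}
    {M : Matrix V V ℝ} {F : Matrix V P ℝ} {H : Matrix Q V ℝ} {σ : V → ℝ} {τ : Fin n → ℝ}
    (hσ : ∀ i, 0 < σ i)
    (hS : (-(S.Aᵀ * diagonal τ + diagonal τ * S.A)).PosSemidef) (hC : S.C = S.Bᵀ * diagonal τ)
    (hM : (Mᵀ * diagonal σ + diagonal σ * M - Hᵀ * H).PosSemidef) :
    (network S M F H).IsDiagObsGramian fun i => σ i.1 * τ i.2 := by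
  have hCt : S.Cᵀ = diagonal τ * S.B := by
    rw [hC, transpose_mul, transpose_transpose, diagonal_transpose]
  have h1 : (S.B * S.C)ᵀ * diagonal τ = S.Cᵀ * S.C := by
    rw [transpose_mul, Matrix.mul_assoc, ← hC]
  have h2 : diagonal τ * (S.B * S.C) = S.Cᵀ * S.C := by
    rw [← Matrix.mul_assoc, ← hCt]
  have h3 : (S.Cᵀ * S.C).PosSemidef := by
    simpa using posSemidef_conjTranspose_mul_self S.C
  have h4 := ((PosDef.diagonal hσ).posSemidef.kronecker hS).add (hM.kronecker h3)
  rw [LinSys.IsDiagObsGramian]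
  refine (congrArg Matrix.PosSemidef ?_).mpr h4
  rw [← diagonal_kronecker_diagonal]
  simp only [network, transpose_sub, ← kroneckerMap_transpose, transpose_one, Matrix.sub_mul,
    Matrix.mul_sub, ← mul_kronecker_mul, Matrix.one_mul, Matrix.mul_one, h1, h2]
  ext i j
  simp only [Matrix.neg_apply, Matrix.add_apply, Matrix.sub_apply, kroneckerMap_apply]
  ring

/-- Dual to the observability case: `B = D Cᵀ` makes the coupling terms equal to `B Bᵀ`. -/
theorem network_isDiagCtrlGramian [Fintype P] {S : LinSys (Fin n) (Fin m) (Fin m)}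
    {M : Matrix V V ℝ} {F : Matrix V P ℝ} {H : Matrix Q V ℝ} {σ : V → ℝ} {τ : Fin n → ℝ}
    (hσ : ∀ i, 0 < σ i)
    (hS : (-(S.A * diagonal τ + diagonal τ * S.Aᵀ)).PosSemidef) (hB : S.B = diagonal τ * S.Cᵀ)
    (hM : (M * diagonal σ + diagonal σ * Mᵀ - F * Fᵀ).PosSemidef) :
    (network S M F H).IsDiagCtrlGramian fun i => σ i.1 * τ i.2 := by
  have hBt : S.Bᵀ = S.C * diagonal τ := by
    rw [hB, transpose_mul, transpose_transpose, diagonal_transpose]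
  have h1 : S.B * S.C * diagonal τ = S.B * S.Bᵀ := by
    rw [Matrix.mul_assoc, ← hBt]
  have h2 : diagonal τ * (S.B * S.C)ᵀ = S.B * S.Bᵀ := by
    rw [transpose_mul, ← Matrix.mul_assoc, ← hB]
  have h3 : (S.B * S.Bᵀ).PosSemidef := by
    simpa using posSemidef_self_mul_conjTranspose S.B
  have h4 := ((PosDef.diagonal hσ).posSemidef.kronecker hS).add (hM.kronecker h3)
  rw [LinSys.IsDiagCtrlGramian]
  refine (congrArg Matrix.PosSemidef ?_).mpr h4
  rw [← diagonal_kronecker_diagonal]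
  simp only [network, transpose_sub, ← kroneckerMap_transpose, transpose_one, Matrix.sub_mul,
    Matrix.mul_sub, ← mul_kronecker_mul, Matrix.one_mul, Matrix.mul_one, h1, h2]
  ext i j
  simp only [Matrix.neg_apply, Matrix.add_apply, Matrix.sub_apply, kroneckerMap_apply]
  ring

theorem network_similar (S : LinSys (Fin n) (Fin m) (Fin m)) (M : Matrix V V ℝ)
    (F : Matrix V P ℝ) (H : Matrix Q V ℝ) {T : Matrix W V ℝ} {T' : Matrix V W ℝ}
    (h : T * T' = 1) (h' : T' * T = 1) {R : Matrix (Fin n) (Fin n) ℝ} (hR : IsUnit R.det) :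
    (network S M F H).Similar (network (S.changeCoords R) (T * M * T') (T * F) (H * T'))
      (T ⊗ₖ R) (T' ⊗ₖ R⁻¹) where
  right_inv := by rw [← mul_kronecker_mul, h, mul_nonsing_inv _ hR, one_kronecker_one]
  left_inv := by rw [← mul_kronecker_mul, h', nonsing_inv_mul _ hR, one_kronecker_one]
  A_eq := by
    have h1 : R * S.B * (S.C * R⁻¹) = R * (S.B * S.C) * R⁻¹ := by simp only [Matrix.mul_assoc]
    simp only [network, LinSys.changeCoords, Matrix.mul_sub, Matrix.sub_mul, ← mul_kronecker_mul,
      Matrix.mul_one, h, h1]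
  B_eq := by simp only [network, LinSys.changeCoords, ← mul_kronecker_mul]
  C_eq := by simp only [network, LinSys.changeCoords, ← mul_kronecker_mul]

theorem network_similar_agent (S : LinSys (Fin n) (Fin m) (Fin m)) (M : Matrix V V ℝ)
    (F : Matrix V P ℝ) (H : Matrix Q V ℝ) {R : Matrix (Fin n) (Fin n) ℝ} (hR : IsUnit R.det) :
    (network S M F H).Similar (network (S.changeCoords R) M F H) (1 ⊗ₖ R) (1 ⊗ₖ R⁻¹) := by
  simpa only [Matrix.one_mul, Matrix.mul_one] using
    network_similar S M F H (Matrix.one_mul 1) (Matrix.one_mul 1) hR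

theorem LinSys.changeCoords_one (S : LinSys (Fin n) (Fin m) (Fin m)) : S.changeCoords 1 = S := by
  simp [LinSys.changeCoords]

theorem network_similar_graph (S : LinSys (Fin n) (Fin m) (Fin m)) (M : Matrix V V ℝ)
    (F : Matrix V P ℝ) (H : Matrix Q V ℝ) {T : Matrix W V ℝ} {T' : Matrix V W ℝ}
    (h : T * T' = 1) (h' : T' * T = 1) :
    (network S M F H).Similar (network S (T * M * T') (T * F) (H * T'))
      (T ⊗ₖ 1) (T' ⊗ₖ (1 : Matrix (Fin n) (Fin n) ℝ)⁻¹) := by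
  simpa only [LinSys.changeCoords_one] using
    network_similar S M F H h h' (R := 1) (by simp)

section Blocks

variable (S : LinSys (Fin n) (Fin m) (Fin m)) (M₁ : Matrix V V ℝ) (M₂ : Matrix W W ℝ)
  (F₁ : Matrix V P ℝ) (F₂ : Matrix W P ℝ) (H₁ : Matrix Q V ℝ) (H₂ : Matrix Q W ℝ)

/-- The parallel connection of two networks of the same agents, as one network. -/
def parallelNetwork : LinSys ((V ⊕ W) × Fin n) (P × Fin m) (Q × Fin m) :=
  network S (fromBlocks M₁ 0 0 M₂) (fromRows F₁ F₂) (fromCols H₁ H₂)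

theorem parallelNetwork_A_mulVec_inl (v : (V ⊕ W) × Fin n → ℂ) (i : V) (a : Fin n) :
    ((parallelNetwork S M₁ M₂ F₁ F₂ H₁ H₂).A.map Complex.ofReal *ᵥ v) (Sum.inl i, a) =
      ((network S M₁ F₁ H₁).A.map Complex.ofReal *ᵥ fun p => v (Sum.inl p.1, p.2)) (i, a) := by
  simp [mulVec, dotProduct, parallelNetwork, network, Fintype.sum_prod_type, one_apply]

theorem parallelNetwork_A_mulVec_inr (v : (V ⊕ W) × Fin n → ℂ) (i : W) (a : Fin n) :
    ((parallelNetwork S M₁ M₂ F₁ F₂ H₁ H₂).A.map Complex.ofReal *ᵥ v) (Sum.inr i, a) =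
      ((network S M₂ F₂ H₂).A.map Complex.ofReal *ᵥ fun p => v (Sum.inr p.1, p.2)) (i, a) := by
  simp [mulVec, dotProduct, parallelNetwork, network, Fintype.sum_prod_type, one_apply]

theorem parallelNetwork_C_mulVec (v : (V ⊕ W) × Fin n → ℂ) :
    (parallelNetwork S M₁ M₂ F₁ F₂ H₁ H₂).C.map Complex.ofReal *ᵥ v =
      ((network S M₁ F₁ H₁).C.map Complex.ofReal *ᵥ fun p => v (Sum.inl p.1, p.2)) +
      ((network S M₂ F₂ H₂).C.map Complex.ofReal *ᵥ fun p => v (Sum.inr p.1, p.2)) := by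
  ext o
  simp [mulVec, dotProduct, parallelNetwork, network, Fintype.sum_prod_type]

variable {S M₁ M₂ F₁ F₂ H₁ H₂}

theorem parallelNetwork_regular {s : ℂ} (h₁ : (network S M₁ F₁ H₁).Regular s)
    (h₂ : (network S M₂ F₂ H₂).Regular s) :
    (parallelNetwork S M₁ M₂ F₁ F₂ H₁ H₂).Regular s := by
  refine LinSys.regular_of_forall fun v hv => ?_
  have e₁ := h₁.eq_zero_of_homogeneous (v := fun p => v (Sum.inl p.1, p.2)) fun p => by
    rw [hv, parallelNetwork_A_mulVec_inl]
  have e₂ := h₂.eq_zero_of_homogeneous (v := fun p => v (Sum.inr p.1, p.2)) fun p => by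
    rw [hv, parallelNetwork_A_mulVec_inr]
  ext ⟨i | i, a⟩
  · exact congrFun e₁ (i, a)
  · exact congrFun e₂ (i, a)

theorem parallelNetwork_transfer [Fintype P] [DecidableEq P] {s : ℂ}
    (h₁ : (network S M₁ F₁ H₁).Regular s) (h₂ : (network S M₂ F₂ H₂).Regular s) :
    (parallelNetwork S M₁ M₂ F₁ F₂ H₁ H₂).transfer s =
      (network S M₁ F₁ H₁).transfer s + (network S M₂ F₂ H₂).transfer s := by
  refine ext_of_mulVec_single fun j => ?_
  set u : P × Fin m → ℂ := Pi.single j 1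
  obtain ⟨x₁, hx₁⟩ := h₁.exists_response u
  obtain ⟨x₂, hx₂⟩ := h₂.exists_response u
  have hx := (parallelNetwork_regular h₁ h₂).transfer_mulVec (u := u)
    (x := fun p => Sum.elim (fun i => x₁ (i, p.2)) (fun i => x₂ (i, p.2)) p.1) (by
      rintro ⟨i | i, a⟩
      · rw [parallelNetwork_A_mulVec_inl]
        exact hx₁ (i, a)
      · rw [parallelNetwork_A_mulVec_inr]
        exact hx₂ (i, a))
  rw [hx, add_mulVec, h₁.transfer_mulVec hx₁, h₂.transfer_mulVec hx₂, parallelNetwork_C_mulVec]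
  rfl

end Blocks

end Network

/-! ### Lyapunov expressions in balanced coordinates -/

namespace IsBalancing

variable {M : ℕ} {T P Q : Matrix (Fin M) (Fin M) ℝ} {d : Fin M → ℝ}

theorem pos (h : IsBalancing T P Q d) (hP : P.PosDef) (i : Fin M) : 0 < d i := by
  have h1 := hP.mul_mul_conjTranspose_same (B := T)
    (vecMul_injective_iff_isUnit.2 ((isUnit_iff_isUnit_det T).2 h.nonsing))
  rw [conjTranspose_eq_transpose_of_trivial, h.ctrl] at h1
  exact posDef_diagonal_iff.1 h1 i

/-- Writing `diag(d)` as `T P Tᵀ` cancels `T⁻¹ T`, so the change of coordinates acts as a congruence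
and semidefiniteness is preserved. -/
theorem ctrl_lyapunov (h : IsBalancing T P Q d) (hP : Pᵀ = P) (Z : Matrix (Fin M) (Fin M) ℝ) :
    T * Z * T⁻¹ * diagonal d + diagonal d * (T * Z * T⁻¹)ᵀ = T * (Z * P + P * Zᵀ) * Tᵀ := by
  have h1 : T * Z * T⁻¹ * diagonal d = T * (Z * P) * Tᵀ := by
    rw [← h.ctrl]
    simp only [Matrix.mul_assoc]
    rw [nonsing_inv_mul_cancel_left _ _ h.nonsing]
  have h2 : diagonal d * (T * Z * T⁻¹)ᵀ = T * (P * Zᵀ) * Tᵀ := by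
    rw [← diagonal_transpose, ← transpose_mul, h1]
    simp only [transpose_mul, transpose_transpose, hP, Matrix.mul_assoc]
  rw [h1, h2, Matrix.mul_add, Matrix.add_mul]

theorem obs_lyapunov (h : IsBalancing T P Q d) (hQ : Qᵀ = Q) (Z : Matrix (Fin M) (Fin M) ℝ) :
    (T * Z * T⁻¹)ᵀ * diagonal d + diagonal d * (T * Z * T⁻¹) =
      (T⁻¹)ᵀ * (Zᵀ * Q + Q * Z) * T⁻¹ := by
  have h1 : diagonal d * (T * Z * T⁻¹) = (T⁻¹)ᵀ * (Q * Z) * T⁻¹ := by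
    rw [← h.obs]
    simp only [Matrix.mul_assoc]
    rw [nonsing_inv_mul_cancel_left _ _ h.nonsing]
  have h2 : (T * Z * T⁻¹)ᵀ * diagonal d = (T⁻¹)ᵀ * (Zᵀ * Q) * T⁻¹ := by
    rw [← diagonal_transpose, ← transpose_mul, h1]
    simp only [transpose_mul, transpose_transpose, hQ, Matrix.mul_assoc]
  rw [h1, h2, Matrix.mul_add, Matrix.add_mul]

end IsBalancing

/-! ### The agent in balanced coordinates -/

section Agent

variable {n m : ℕ} {S : LinSys (Fin n) (Fin m) (Fin m)} {K₁ K₂ T : Matrix (Fin n) (Fin n) ℝ}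
  {τ : Fin n → ℝ}

theorem LinSys.IsKYP.balanced_obs (h : IsBalancing T K₂⁻¹ K₁ τ) (hK : S.IsKYP K₁) :
    (-((S.changeCoords T).Aᵀ * diagonal τ + diagonal τ * (S.changeCoords T).A)).PosSemidef ∧
      (S.changeCoords T).C = (S.changeCoords T).Bᵀ * diagonal τ := by
  obtain ⟨hpd, hle, hC⟩ := hK
  have hsymm : K₁ᵀ = K₁ := hpd.isHermitian
  constructor
  · simp only [LinSys.changeCoords]
    rw [h.obs_lyapunov hsymm, ← Matrix.neg_mul, ← Matrix.mul_neg]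
    simpa using hle.conjTranspose_mul_mul_same T⁻¹
  · simp only [LinSys.changeCoords]
    rw [← h.obs, hC, transpose_mul]
    simp only [← Matrix.mul_assoc]
    rw [Matrix.mul_assoc S.Bᵀ Tᵀ, ← transpose_mul, nonsing_inv_mul _ h.nonsing, transpose_one,
      Matrix.mul_one]

/-- Congruence by `K₂⁻¹` turns the KYP inequality into `A K₂⁻¹ + K₂⁻¹ Aᵀ ≤ 0`, and `C = Bᵀ K₂`
becomes `B = K₂⁻¹ Cᵀ`. Congruence by `T` then replaces `K₂⁻¹` by `diag(τ)`. -/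
theorem LinSys.IsKYP.balanced_ctrl (h : IsBalancing T K₂⁻¹ K₁ τ) (hK : S.IsKYP K₂) :
    (-((S.changeCoords T).A * diagonal τ + diagonal τ * (S.changeCoords T).Aᵀ)).PosSemidef ∧
      (S.changeCoords T).B = diagonal τ * (S.changeCoords T).Cᵀ := by
  obtain ⟨hpd, hle, hC⟩ := hK
  have hsymm : K₂ᵀ = K₂ := hpd.isHermitian
  have hsymm' : (K₂⁻¹)ᵀ = K₂⁻¹ := by rw [transpose_nonsing_inv, hsymm]
  have hdet : IsUnit K₂.det := (isUnit_iff_isUnit_det _).1 hpd.isUnit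
  constructor
  · simp only [LinSys.changeCoords]
    rw [h.ctrl_lyapunov hsymm', ← Matrix.neg_mul, ← Matrix.mul_neg]
    have h1 := (hle.conjTranspose_mul_mul_same K₂⁻¹).mul_mul_conjTranspose_same T
    have h2 : K₂⁻¹ * -(S.Aᵀ * K₂ + K₂ * S.A) * K₂⁻¹ = -(S.A * K₂⁻¹ + K₂⁻¹ * S.Aᵀ) := by
      rw [Matrix.mul_neg, Matrix.neg_mul, Matrix.mul_add, Matrix.add_mul,
        nonsing_inv_mul_cancel_left _ _ hdet, ← Matrix.mul_assoc,
        mul_nonsing_inv_cancel_right _ _ hdet, add_comm]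
    simpa only [conjTranspose_eq_transpose_of_trivial, hsymm', h2] using h1
  · simp only [LinSys.changeCoords]
    rw [← h.ctrl, hC, transpose_mul, transpose_mul, transpose_transpose, hsymm]
    simp only [Matrix.mul_assoc]
    rw [← Matrix.mul_assoc Tᵀ, ← transpose_mul, nonsing_inv_mul _ h.nonsing, transpose_one,
      Matrix.one_mul, nonsing_inv_mul_cancel_left _ _ hdet]

end Agent

/-! ### The graph in balanced coordinates and its truncation -/

section Graph

variable {M p q : ℕ} {lam : Fin M → ℝ} {Fb : Matrix (Fin M) (Fin p) ℝ}
  {Hb : Matrix (Fin q) (Fin M) ℝ} {X Y T : Matrix (Fin M) (Fin M) ℝ} {σ : Fin M → ℝ}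

/-- The Lyapunov relation for `X` is an equation, so this matrix is in fact zero. -/
theorem IsGraphCtrlGramian.balanced (hX : IsGraphCtrlGramian lam Fb X)
    (h : IsBalancing T X Y σ) :
    (T * diagonal lam * T⁻¹ * diagonal σ + diagonal σ * (T * diagonal lam * T⁻¹)ᵀ
      - T * Fb * (T * Fb)ᵀ).PosSemidef := by
  obtain ⟨hpd, heq⟩ := hX
  have h1 : diagonal lam * X + X * diagonal lam = Fb * Fbᵀ := by
    rw [← sub_eq_zero, ← neg_eq_zero, ← heq]
    abel
  rw [h.ctrl_lyapunov hpd.isHermitian, diagonal_transpose, h1, transpose_mul]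
  simp only [Matrix.mul_assoc, sub_self]
  exact PosSemidef.zero

theorem IsGraphObsGramian.balanced (hY : IsGraphObsGramian lam Hb Y)
    (h : IsBalancing T X Y σ) :
    ((T * diagonal lam * T⁻¹)ᵀ * diagonal σ + diagonal σ * (T * diagonal lam * T⁻¹)
      - (Hb * T⁻¹)ᵀ * (Hb * T⁻¹)).PosSemidef := by
  obtain ⟨hpd, -, hle⟩ := hY
  have h1 := hle.conjTranspose_mul_mul_same T⁻¹
  have h2 : (Hb * T⁻¹)ᵀ * (Hb * T⁻¹) = (T⁻¹)ᵀ * (Hbᵀ * Hb) * T⁻¹ := by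
    simp only [transpose_mul, Matrix.mul_assoc]
  rw [h.obs_lyapunov hpd.isHermitian, diagonal_transpose, h2, ← Matrix.sub_mul, ← Matrix.mul_sub]
  have h3 : -(-(diagonal lam * Y) - Y * diagonal lam + Hbᵀ * Hb) =
      diagonal lam * Y + Y * diagonal lam - Hbᵀ * Hb := by abel
  simpa only [conjTranspose_eq_transpose_of_trivial, h3] using h1

/-- Keeping every agent state on the retained graph indices is a truncation of the whole Kronecker
system, so the general truncation bound applies to it. -/
theorem network_truncate {n m d : ℕ} (h : d ≤ M) (S : LinSys (Fin n) (Fin m) (Fin m)) :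
    (network S (T * diagonal lam * T⁻¹) (T * Fb) (Hb * T⁻¹)).truncate
      (Prod.map (Fin.castLE h) id) =
      network S (truncLam h T lam) (truncF h T Fb) (truncH h T Hb) := by
  simp only [LinSys.truncate, network, LinSys.mk.injEq]
  refine ⟨?_, rfl, rfl⟩
  ext ⟨i, a⟩ ⟨j, b⟩
  simp [truncLam, one_apply]

end Graph

/-! ### Separation of the average mode -/

section Separation

variable {n m N p q : ℕ}

theorem IsSpectralDecomp.network_similar {L : Matrix (Fin N) (Fin N) ℝ}
    {T₁ : Matrix (Fin N) (Fin (N - 1)) ℝ} {lam : Fin (N - 1) → ℝ} (h : IsSpectralDecomp L T₁ lam)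
    (S : LinSys (Fin n) (Fin m) (Fin m)) (F : Matrix (Fin N) (Fin p) ℝ)
    (H : Matrix (Fin q) (Fin N) ℝ) :
    (parallelNetwork S (diagonal lam) (0 : Matrix Unit Unit ℝ) (T₁ᵀ * F) ((avgCol N)ᵀ * F)
      (H * T₁) (H * avgCol N)).Similar (network S L F H)
      (fromCols T₁ (avgCol N) ⊗ₖ 1)
      ((fromCols T₁ (avgCol N))ᵀ ⊗ₖ (1 : Matrix (Fin n) (Fin n) ℝ)⁻¹) := by
  have h1 := network_similar_graph S (fromBlocks (diagonal lam) 0 0 (0 : Matrix Unit Unit ℝ))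
    (fromRows (T₁ᵀ * F) ((avgCol N)ᵀ * F)) (fromCols (H * T₁) (H * avgCol N)) h.orth' h.orth
  rw [← h.eq, ← fromRows_mul, ← transpose_fromCols, ← Matrix.mul_assoc, h.orth', Matrix.one_mul,
    ← mul_fromCols, Matrix.mul_assoc, h.orth', Matrix.mul_one] at h1
  simpa only [parallelNetwork, mul_fromCols, transpose_fromCols, fromRows_mul] using h1

end Separation

end NetBT

/-! ### Assembly of the main theorem -/

namespace NetBT

theorem hInfNorm_congr {μ ο : Type*} [Fintype μ] [DecidableEq μ] [Fintype ο]
    {G₁ G₂ : ℂ → Matrix ο μ ℂ} (h : ∀ s : ℂ, 0 < s.re → G₁ s = G₂ s) :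
    hInfNorm G₁ = hInfNorm G₂ :=
  iSup_congr fun s => by rw [h s.1 s.2]

theorem MemHInf.congr {μ ο : Type*} [Fintype μ] [DecidableEq μ] [Fintype ο]
    {G₁ G₂ : ℂ → Matrix ο μ ℂ} (hG : MemHInf G₁) (h : ∀ s : ℂ, 0 < s.re → G₂ s = G₁ s) :
    MemHInf G₂ :=
  ⟨fun i j => (hG.1 i j).congr fun s hs => by simp only [h s hs],
    (hInfNorm_congr h).trans_lt hG.2⟩

end NetBT

theorem mainTheorem6
    {N n m p q k : ℕ} (hk : 1 ≤ k) (hkN : k ≤ N)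
    -- the agents
    (agent : NetBT.LinSys (Fin n) (Fin m) (Fin m))
    (hmin : agent.Minimal) (hpas : agent.Passive)
    -- the network
    (w : Fin N → Fin N → ℝ) (hw : NetBT.IsConnectedWeight w)
    (F : Matrix (Fin N) (Fin p) ℝ) (H : Matrix (Fin q) (Fin N) ℝ)
    -- separation
    (T₁ : Matrix (Fin N) (Fin (N - 1)) ℝ) (lam : Fin (N - 1) → ℝ)
    (hT : NetBT.IsSpectralDecomp (NetBT.laplacian w) T₁ lam)
    -- Gramians
    (X Y : Matrix (Fin (N - 1)) (Fin (N - 1)) ℝ)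
    (hX : NetBT.IsGraphCtrlGramian lam (T₁ᵀ * F) X)
    (hY : NetBT.IsGraphObsGramian lam (H * T₁) Y)
    (Kmin Kmax : Matrix (Fin n) (Fin n) ℝ)
    (hKmin : agent.IsMinKYP Kmin) (hKmax : agent.IsMaxKYP Kmax)
    -- balancing
    (TG : Matrix (Fin (N - 1)) (Fin (N - 1)) ℝ) (σ : Fin (N - 1) → ℝ)
    (hTG : NetBT.IsBalancing TG X Y σ)
    (TD : Matrix (Fin n) (Fin n) ℝ) (τ : Fin n → ℝ)
    (hTD : NetBT.IsBalancing TD Kmax⁻¹ Kmin τ)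
    -- the unreduced agent, in arbitrary state coordinates
    (R : Matrix (Fin n) (Fin n) ℝ) (hR : IsUnit R.det)
    (agent' : NetBT.LinSys (Fin n) (Fin m) (Fin m)) (hagent' : agent' = agent.changeCoords R)
    -- truncation of the network to order `k - 1`
    (Lam₁ : Matrix (Fin (k - 1)) (Fin (k - 1)) ℝ)
    (hLam₁ : Lam₁ = NetBT.truncLam (Nat.sub_le_sub_right hkN 1) TG lam)
    (F₁ : Matrix (Fin (k - 1)) (Fin p) ℝ)
    (hF₁ : F₁ = NetBT.truncF (Nat.sub_le_sub_right hkN 1) TG (T₁ᵀ * F))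
    (H₁ : Matrix (Fin q) (Fin (k - 1)) ℝ)
    (hH₁ : H₁ = NetBT.truncH (Nat.sub_le_sub_right hkN 1) TG (H * T₁))
    -- network realization: `Tn` is nonsingular with inverse `Tn'`
    (Tn : Matrix (Fin (k - 1) ⊕ Unit) (Fin k) ℝ) (Tn' : Matrix (Fin k) (Fin (k - 1) ⊕ Unit) ℝ)
    (hTn : Tn * Tn' = 1) (hTn' : Tn' * Tn = 1)
    (what : Fin k → Fin k → ℝ) (hwhat : NetBT.IsConnectedWeight what)
    (hLhat : NetBT.laplacian what = Tn' * NetBT.calN Lam₁ * Tn)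
    -- the full and reduced networks, and their stable parts
    (Sig : NetBT.LinSys (Fin N × Fin n) (Fin p × Fin m) (Fin q × Fin m))
    (hSig : Sig = NetBT.network agent (NetBT.laplacian w) F H)
    (SigHat : NetBT.LinSys (Fin k × Fin n) (Fin p × Fin m) (Fin q × Fin m))
    (hSigHat : SigHat = NetBT.network agent' (NetBT.laplacian what)
      (Tn' * NetBT.calF F₁ F) (NetBT.calH H₁ H * Tn))
    (SigS : NetBT.LinSys (Fin (N - 1) × Fin n) (Fin p × Fin m) (Fin q × Fin m))
    (hSigS : SigS = NetBT.network agent (Matrix.diagonal lam) (T₁ᵀ * F) (H * T₁))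
    (SigSHat : NetBT.LinSys (Fin (k - 1) × Fin n) (Fin p × Fin m) (Fin q × Fin m))
    (hSigSHat : SigSHat = NetBT.network agent' Lam₁ F₁ H₁) :
    NetBT.MemHInf (NetBT.errorTransfer Sig SigHat) ∧
    NetBT.MemHInf (NetBT.errorTransfer SigS SigSHat) ∧
    NetBT.hInfNorm (NetBT.errorTransfer Sig SigHat) =
      NetBT.hInfNorm (NetBT.errorTransfer SigS SigSHat) ∧
    NetBT.hInfNorm (NetBT.errorTransfer SigS SigSHat) ≤
      ENNReal.ofReal (2 * ∑ i ∈ Finset.univ.filter (fun i : Fin (N - 1) => k - 1 ≤ (i : ℕ)),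
        ∑ j : Fin n, σ i * τ j) := by
  have hle := Nat.sub_le_sub_right hkN 1
  have hσ := hTG.pos hX.1
  have hτ := hTD.pos hKmax.1.1.inv
  have hd : ∀ i : Fin (N - 1) × Fin n, 0 < σ i.1 * τ i.2 := fun i => mul_pos (hσ i.1) (hτ i.2)
  obtain ⟨hobsA, hobsC⟩ := NetBT.LinSys.IsKYP.balanced_obs hTD hKmin.1
  obtain ⟨hctrlA, hctrlB⟩ := NetBT.LinSys.IsKYP.balanced_ctrl hTD hKmax.1
  set balAgent := agent.changeCoords TD with hbalAgent
  set bal := NetBT.network balAgent (TG * Matrix.diagonal lam * TG⁻¹) (TG * (T₁ᵀ * F))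
    (H * T₁ * TG⁻¹) with hbal
  have hobs : bal.IsDiagObsGramian fun i => σ i.1 * τ i.2 :=
    NetBT.network_isDiagObsGramian hσ hobsA hobsC (hY.balanced hTG)
  have hctrl : bal.IsDiagCtrlGramian fun i => σ i.1 * τ i.2 :=
    NetBT.network_isDiagCtrlGramian hσ hctrlA hctrlB (hX.balanced hTG)
  have htrunc : bal.truncate (Prod.map (Fin.castLE hle) id) =
      NetBT.network balAgent Lam₁ F₁ H₁ := by
    rw [hLam₁, hF₁, hH₁]
    exact NetBT.network_truncate hle balAgent
  have hregBal {s : ℂ} (hs : 0 < s.re) : bal.Regular s := hobs.regular hd hs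
  have hregTrunc {s : ℂ} (hs : 0 < s.re) : (NetBT.network balAgent Lam₁ F₁ H₁).Regular s := by
    rw [← htrunc]
    exact (hobs.truncate _).regular (fun i => hd _) hs
  -- the balanced realizations have the same transfer functions
  have hsimS : SigS.Similar bal _ _ := hSigS ▸
    NetBT.network_similar agent (Matrix.diagonal lam) (T₁ᵀ * F) (H * T₁)
      (Matrix.mul_nonsing_inv TG hTG.nonsing) (Matrix.nonsing_inv_mul TG hTG.nonsing) hTD.nonsing
  -- Regularity is first obtained in balanced coordinates, where the Gramian is diagonal, and is
  -- carried back by similarity.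
  have hregS {s : ℂ} (hs : 0 < s.re) : SigS.Regular s := hsimS.symm.regular (hregBal hs)
  -- The truncation bound needs the agent in the coordinates `TD`, whereas the reduced model uses
  -- `R`. Both are compared with the original agent.
  have hsimBal := NetBT.network_similar_agent agent Lam₁ F₁ H₁ hTD.nonsing
  have hsimHat : (NetBT.network agent Lam₁ F₁ H₁).Similar SigSHat _ _ := hSigSHat ▸ hagent' ▸
    NetBT.network_similar_agent agent Lam₁ F₁ H₁ hR
  have hregHat {s : ℂ} (hs : 0 < s.re) : SigSHat.Regular s :=
    hsimHat.regular (hsimBal.symm.regular (hregTrunc hs))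
  have htransfer {s : ℂ} (hs : 0 < s.re) : NetBT.errorTransfer SigS SigSHat s =
      bal.transfer s - (bal.truncate (Prod.map (Fin.castLE hle) id)).transfer s := by
    rw [NetBT.errorTransfer, htrunc, hsimS.symm.transfer_eq (hregBal hs),
      hsimHat.transfer_eq (hsimBal.symm.regular (hregTrunc hs)),
      hsimBal.symm.transfer_eq (hregTrunc hs)]
  -- the average parts of the two networks agree
  set avg := NetBT.network agent (0 : Matrix Unit Unit ℝ) ((NetBT.avgCol N)ᵀ * F)
    (H * NetBT.avgCol N) with havg
  set avg' := NetBT.network agent' (0 : Matrix Unit Unit ℝ) ((NetBT.avgCol N)ᵀ * F)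
    (H * NetBT.avgCol N) with havg'
  have hsimAvgBal := NetBT.network_similar_agent agent (0 : Matrix Unit Unit ℝ)
    ((NetBT.avgCol N)ᵀ * F) (H * NetBT.avgCol N) hTD.nonsing
  have hsimAvg : avg.Similar avg' _ _ := havg' ▸ hagent' ▸
    NetBT.network_similar_agent agent (0 : Matrix Unit Unit ℝ)
      ((NetBT.avgCol N)ᵀ * F) (H * NetBT.avgCol N) hR
  -- With graph matrix `0` the Gramian condition becomes `-Hᵀ H ≥ 0`, so the output is replaced by
  -- `0`. Regularity depends only on the state matrix, so nothing is lost.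
  have hobsAvg : (NetBT.network balAgent (0 : Matrix Unit Unit ℝ) ((NetBT.avgCol N)ᵀ * F)
      (0 : Matrix (Fin q) Unit ℝ)).IsDiagObsGramian fun i => 1 * τ i.2 :=
    NetBT.network_isDiagObsGramian (σ := fun _ => 1) (fun _ => one_pos) hobsA hobsC
      (by simpa using Matrix.PosSemidef.zero)
  have hregAvg {s : ℂ} (hs : 0 < s.re) : avg.Regular s :=
    hsimAvgBal.symm.regular (hobsAvg.regular (fun i => mul_pos one_pos (hτ i.2)) hs)
  have hsimSig := hSig ▸ hT.network_similar agent F H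
  have hsimSigHat : (NetBT.parallelNetwork agent' Lam₁ (0 : Matrix Unit Unit ℝ) F₁
      ((NetBT.avgCol N)ᵀ * F) H₁ (H * NetBT.avgCol N)).Similar SigHat
      (Tn' ⊗ₖ 1) (Tn ⊗ₖ (1 : Matrix (Fin n) (Fin n) ℝ)⁻¹) := by
    rw [hSigHat, hLhat]
    exact NetBT.network_similar_graph agent' (NetBT.calN Lam₁) (NetBT.calF F₁ F)
      (NetBT.calH H₁ H) hTn' hTn
  have herr (s : ℂ) (hs : 0 < s.re) :
      NetBT.errorTransfer Sig SigHat s = NetBT.errorTransfer SigS SigSHat s := by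
    have h1 := hregS hs
    have h2 := hregHat hs
    rw [hSigS] at h1
    rw [hSigSHat] at h2
    have h3 := hsimAvg.regular (hregAvg hs)
    rw [NetBT.errorTransfer, NetBT.errorTransfer,
      hsimSig.transfer_eq (NetBT.parallelNetwork_regular h1 (hregAvg hs)),
      hsimSigHat.transfer_eq (NetBT.parallelNetwork_regular h2 h3),
      NetBT.parallelNetwork_transfer h1 (hregAvg hs), NetBT.parallelNetwork_transfer h2 h3,
      hsimAvg.transfer_eq (hregAvg hs), hSigS, hSigSHat, add_sub_add_right_eq_sub]
  -- Indices of `Fin (N - 1)` start at `0`, so `k - 1 ≤ i` is the range from `k` to `N - 1` in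
  -- one-based numbering.
  have hbound : NetBT.hInfNorm (NetBT.errorTransfer SigS SigSHat) ≤
      ENNReal.ofReal (2 * ∑ i ∈ Finset.univ.filter (fun i : Fin (N - 1) => k - 1 ≤ (i : ℕ)),
        ∑ j : Fin n, σ i * τ j) := by
    refine iSup_le fun ⟨s, hs⟩ => ?_
    rw [htransfer hs, ← Finset.sum_product']
    refine NetBT.LinSys.specNorm_sub_truncate_le hd hobs hctrl
      ((Fin.castLE_injective hle).prodMap Function.injective_id) (fun i => ?_) hs
    rw [Set.range_prodMap, Set.range_id, Fin.range_castLE]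
    simp
  -- Boundedness is read off from the error bound. Membership for the full networks then follows
  -- because the two error functions agree on `Re s > 0`.
  have hmem : NetBT.MemHInf (NetBT.errorTransfer SigS SigSHat) :=
    ⟨fun i j => (SigS.differentiableOn_transfer (fun _ hs => hregS hs) i j).sub
      (SigSHat.differentiableOn_transfer (fun _ hs => hregHat hs) i j),
      hbound.trans_lt ENNReal.ofReal_lt_top⟩
  exact ⟨hmem.congr herr, hmem, NetBT.hInfNorm_congr herr, hbound⟩
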